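/- A numerical semigroup is a submonoid $S$ of $(\mathbb{N},+)$ with finite complement. Write $S^*=S\setminus\{0\}$, let $P(S)=S^*\setminus(S^*+S^*)$ be its set of primitive elements, $e(S)=|P(S)|$ its embedding dimension, $m(S)=\min S^*$ its multiplicity, $g(S)=|\mathbb{N}\setminus S|$ its genus, $F(S)=\max(\mathbb{Z}\setminus S)$ its Frobenius number, $c(S)=F(S)+1$ its conductor, and $L(S)=\{a\in S : a<F(S)\}$ its left part. One says that $S$ satisfies Wilf's conjecture if $e(S)\,|L(S)|\ge c(S)$. A child of $S$ is a numerical semigroup of the form $S\setminus\{a\}$ with $a\in P(S)$ and $a>F(S)$; a descendant of $S$ is a numerical semigroup obtained from $S$ by finitely many (possibly zero) successive passages to a child. Corollary. Let $G\ge 1$ be an integer and let $S$ be a numerical semigroup of genus $g(S)\le G$ such that $$e(S)\ \ge\ \frac{m(S)}{3}+(G-g(S)).$$ Then every descendant $T$ of $S$ of genus $g(T)\le G$ satisfies Wilf's conjecture. -/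

import Mathlib

/-- A numerical semigroup: a submonoid of `ℕ` with finite complement. -/
@[ext]
structure NumericalSemigroup extends AddSubmonoid ℕ where
  finite_compl' : (carrierᶜ).Finite

namespace NumericalSemigroup

instance : SetLike NumericalSemigroup ℕ where
  coe S := S.carrier
  coe_injective := by
    intro S T h
    cases S
    cases T
    congr
    exact SetLike.coe_injective h

theorem finite_compl (S : NumericalSemigroup) : ((S : Set ℕ)ᶜ).Finite := S.finite_compl'

/-- `S* = S \ {0}`. -/
def star (S : NumericalSemigroup) : Set ℕ := {a | a ∈ S ∧ a ≠ 0}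

/-- The set `P` of primitive elements: nonzero elements of `S` that are not the sum of two
nonzero elements of `S`. -/
def primitives (S : NumericalSemigroup) : Set ℕ :=
  {a | a ∈ S.star ∧ ¬ ∃ x ∈ S.star, ∃ y ∈ S.star, x + y = a}

/-- The embedding dimension `e = |P|` (`P` is finite, see `finite_primitives`). -/
noncomputable def embeddingDimension (S : NumericalSemigroup) : ℕ := S.primitives.ncard

/-- The multiplicity `m = min S*` (attained, see `isLeast_multiplicity`). -/
noncomputable def multiplicity (S : NumericalSemigroup) : ℕ := sInf S.star

/-- The genus `g = |ℕ \ S|`. -/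
noncomputable def genus (S : NumericalSemigroup) : ℕ := ((S : Set ℕ)ᶜ).ncard

/-- The set `ℤ \ S`. -/
def intGaps (S : NumericalSemigroup) : Set ℤ := {z | ¬ ∃ a ∈ S, (a : ℤ) = z}

/-- The Frobenius number `F = max (ℤ \ S)` (attained, see `isGreatest_frobenius`);
it is `-1` when `S = ℕ`. -/
noncomputable def frobenius (S : NumericalSemigroup) : ℤ := sSup S.intGaps

/-- The conductor `c = F + 1`. -/
noncomputable def conductor (S : NumericalSemigroup) : ℤ := S.frobenius + 1

/-- The left part `L = {a ∈ S | a < F}`. -/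
def leftPart (S : NumericalSemigroup) : Set ℕ := {a | a ∈ S ∧ (a : ℤ) < S.frobenius}

/-- The right part `R = {a ∈ S | a > F}`. -/
def rightPart (S : NumericalSemigroup) : Set ℕ := {a | a ∈ S ∧ S.frobenius < (a : ℤ)}

/-- `S` satisfies Wilf's conjecture: `e |L| ≥ c`. -/
def SatisfiesWilf (S : NumericalSemigroup) : Prop :=
  (S.embeddingDimension : ℤ) * (S.leftPart.ncard : ℤ) ≥ S.conductor

/-- `S'` is a child of `S`: `S' = S \ {a}` for some right primitive element `a` of `S`. -/
def IsChild (S' S : NumericalSemigroup) : Prop :=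
  ∃ a ∈ S.primitives ∩ S.rightPart, (S' : Set ℕ) = (S : Set ℕ) \ {a}

/-- `T` is a descendant of `S`: it is reached from `S` by finitely many (possibly zero) passages
to a child. -/
def IsDescendant (T S : NumericalSemigroup) : Prop :=
  Relation.ReflTransGen (fun A B : NumericalSemigroup => B.IsChild A) S T

theorem isGreatest_frobenius (S : NumericalSemigroup) : IsGreatest S.intGaps S.frobenius := by
  have hne : S.intGaps.Nonempty := ⟨-1, by rintro ⟨a, -, h⟩; omega⟩
  have hbdd : BddAbove S.intGaps := by
    obtain ⟨N, hN⟩ := S.finite_compl.bddAbove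
    refine ⟨(N : ℤ), fun z hz => ?_⟩
    by_contra hlt
    push Not at hlt
    refine hz ⟨z.toNat, ?_, by omega⟩
    by_contra hmem
    have := hN (show z.toNat ∈ (S : Set ℕ)ᶜ from hmem)
    omega
  exact ⟨Int.csSup_mem hne hbdd, fun z hz => le_csSup hbdd hz⟩

theorem mem_of_frobenius_lt (S : NumericalSemigroup) {a : ℕ} (h : S.frobenius < (a : ℤ)) :
    a ∈ S := by
  by_contra ha
  have : (a : ℤ) ∈ S.intGaps := by
    rintro ⟨b, hb, hba⟩
    exact ha (by rwa [← Int.ofNat_inj.mp hba])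
  exact absurd (S.isGreatest_frobenius.2 this) (not_le.mpr h)

theorem isLeast_multiplicity (S : NumericalSemigroup) : IsLeast S.star S.multiplicity := by
  have hne : S.star.Nonempty :=
    ⟨S.frobenius.toNat + 1, S.mem_of_frobenius_lt (by push_cast; omega), by omega⟩
  exact ⟨Nat.sInf_mem hne, fun a ha => Nat.sInf_le ha⟩

theorem finite_primitives (S : NumericalSemigroup) : S.primitives.Finite := by
  refine (Set.finite_Iic (S.frobenius.toNat + S.multiplicity)).subset fun a ha => ?_
  by_contra hlt
  simp only [Set.mem_Iic, not_le] at hlt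
  exact ha.2 ⟨S.multiplicity, S.isLeast_multiplicity.1, a - S.multiplicity,
    ⟨S.mem_of_frobenius_lt (by omega), by omega⟩, by omega⟩

theorem finite_leftPart (S : NumericalSemigroup) : S.leftPart.Finite :=
  (Set.finite_Iic S.frobenius.toNat).subset fun a ha => by
    have := ha.2
    simp only [Set.mem_Iic]
    omega

end NumericalSemigroup

/-!
Passing to a child raises the genus by one and lowers `3 e - m` by at most three: if the
multiplicity `m` itself is removed, then it grows by one but `2 m + 1` becomes primitive. Hence
every descendant of genus at most `G` satisfies `m ≤ 3 e`, and under this condition Wilf's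
conjecture holds (a theorem of Eliahou).

Every element of `S` is `w + k m` for a unique `w` in the Apéry set with respect to `m`, and
`level w` is the number of such elements below the conductor `c`. So `|L|` is the depth
`q = ⌈c / m⌉` plus the sum of the levels of the nonzero Apéry elements. Exactly `m - e` of these are
decomposable, and Wilf's inequality follows once `e` times the total level pays a cost of `q`, or
`q - 1` for large elements, per decomposable one.

The cost of `x + y` is at most `level x + level y`, so the sums of two Apéry primitives are paid for
by the primitives: there are `e - 1` of them, and each contributes its level `e` times. If the total
level is at least `2 q`, then `m ≤ 3 e` suffices. Otherwise few sums of three primitives can occur.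
Either all of them are of the form `3 x`, and the levels of the multiples of `x` pay for those sums,
or some `2 u + x` with `x ≠ u` occurs, and then the partial sums of `u + u + x`, with at most one
further element, use up the total level. For `3 ≤ e` this covers everything; for `e = 2` the
semigroup is symmetric, so that `c = 2 |L|`.
-/

open scoped Finset

theorem sum_sym2_add_map {α M : Type*} [AddCommMonoid M] (s : Finset α)
    (f : α → M) : ∑ p ∈ s.sym2, (p.map f).add = (#s + 1) • ∑ x ∈ s, f x := by
  classical
  induction s using Finset.induction_on with
  | empty => simp
  | insert a s ha ih =>
    have hinj : Set.InjOn (fun b => s(a, b)) (insert a s : Finset α) :=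
      fun b _ c _ h => Sym2.congr_right.1 h
    have hdisj : Disjoint ((insert a s).image fun b => s(a, b)) s.sym2 := by
      refine Finset.disjoint_left.2 fun p hp hps => ?_
      obtain ⟨b, -, rfl⟩ := Finset.mem_image.1 hp
      exact ha (Finset.mk_mem_sym2_iff.1 hps).1
    rw [Finset.sym2_insert, Finset.sum_union hdisj, Finset.sum_image hinj, ih]
    simp only [Sym2.map_mk, Sym2.add_mk, Finset.sum_add_distrib, Finset.sum_const,
      Finset.card_insert_of_notMem ha, Finset.sum_insert ha, add_smul, one_smul, smul_add]
    abel

theorem sum_map_le_sum_of_nodup {α : Type*} {s : Finset α} {l : List α}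
    (hl : l.Nodup) (hs : ∀ x ∈ l, x ∈ s) (f : α → ℕ) : (l.map f).sum ≤ ∑ x ∈ s, f x := by
  classical
  rw [← List.sum_toFinset f hl]
  exact Finset.sum_le_sum_of_subset fun x hx => hs x (List.mem_toFinset.1 hx)

namespace NumericalSemigroup

instance : AddSubmonoidClass NumericalSemigroup ℕ where
  add_mem {S} := S.toAddSubmonoid.add_mem
  zero_mem S := S.toAddSubmonoid.zero_mem

section Basic

variable {S : NumericalSemigroup} {a b : ℕ}

theorem add_mem_star (ha : a ∈ S.star) (hb : b ∈ S) : a + b ∈ S.star :=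
  ⟨add_mem ha.1 hb, by have := ha.2; omega⟩

theorem mul_mem (k : ℕ) (ha : a ∈ S) : k * a ∈ S := by
  simpa only [smul_eq_mul] using nsmul_mem ha k

theorem pos_of_mem_star (ha : a ∈ S.star) : 0 < a := Nat.pos_of_ne_zero ha.2

theorem multiplicity_mem (S : NumericalSemigroup) : S.multiplicity ∈ S :=
  S.isLeast_multiplicity.1.1

theorem multiplicity_pos (S : NumericalSemigroup) : 0 < S.multiplicity :=
  pos_of_mem_star S.isLeast_multiplicity.1

theorem multiplicity_le (ha : a ∈ S.star) : S.multiplicity ≤ a := S.isLeast_multiplicity.2 ha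

theorem frobenius_ne (ha : a ∈ S) : S.frobenius ≠ a :=
  fun h => S.isGreatest_frobenius.1 ⟨a, ha, h.symm⟩

/-- The conductor as a natural number; it is never negative because `-1` is an integer gap. -/
noncomputable def natConductor (S : NumericalSemigroup) : ℕ := S.conductor.toNat

theorem natCast_natConductor (S : NumericalSemigroup) : (S.natConductor : ℤ) = S.conductor := by
  have : -1 ≤ S.frobenius := S.isGreatest_frobenius.2 (by rintro ⟨a, -, h⟩; omega)
  rw [natConductor, Int.toNat_of_nonneg]
  unfold conductor
  omega

theorem mem_of_natConductor_le (h : S.natConductor ≤ a) : a ∈ S := by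
  refine S.mem_of_frobenius_lt ?_
  have := S.natCast_natConductor
  unfold conductor at this
  omega

theorem mem_leftPart_iff : a ∈ S.leftPart ↔ a ∈ S ∧ a < S.natConductor := by
  have := S.natCast_natConductor
  unfold conductor at this
  refine and_congr_right fun ha => ?_
  have := frobenius_ne ha
  omega

theorem satisfiesWilf_iff :
    S.SatisfiesWilf ↔ S.natConductor ≤ S.embeddingDimension * S.leftPart.ncard := by
  rw [SatisfiesWilf, ← natCast_natConductor, ge_iff_le]
  norm_cast

theorem exists_primitive_add (ha : a ∈ S.star) : ∃ p ∈ S.primitives, ∃ r ∈ S, p + r = a := by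
  induction a using Nat.strong_induction_on with
  | _ a ih =>
    by_cases hp : a ∈ S.primitives
    · exact ⟨a, hp, 0, zero_mem S, rfl⟩
    obtain ⟨x, hx, y, hy, rfl⟩ : ∃ x ∈ S.star, ∃ y ∈ S.star, x + y = a := by
      by_contra h
      exact hp ⟨ha, h⟩
    obtain ⟨p, hpP, r, hr, rfl⟩ := ih x (by have := pos_of_mem_star hy; omega) hx
    exact ⟨p, hpP, r + y, add_mem hr hy.1, (add_assoc p r y).symm⟩

theorem add_notMem_primitives (ha : a ∈ S.star) (hb : b ∈ S.star) : a + b ∉ S.primitives :=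
  fun h => h.2 ⟨a, ha, b, hb, rfl⟩

end Basic

section Apery

variable {S : NumericalSemigroup} {w x y z : ℕ}

open Classical in
/-- The nonzero elements of the Apéry set of `S` with respect to its multiplicity `m`: the nonzero
`w ∈ S` with `w - m ∉ S`. -/
noncomputable def apery (S : NumericalSemigroup) : Finset ℕ :=
  {w ∈ Finset.range (S.natConductor + S.multiplicity) |
    w ∈ S.star ∧ ∀ s ∈ S, s + S.multiplicity ≠ w}

open Classical in
/-- The primitive elements of `S` other than its multiplicity. -/
noncomputable def aperyPrimitives (S : NumericalSemigroup) : Finset ℕ :=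
  {w ∈ S.apery | w ∈ S.primitives}

open Classical in
/-- The elements of the Apéry set that are sums of two nonzero elements of `S`. -/
noncomputable def decomposables (S : NumericalSemigroup) : Finset ℕ :=
  {w ∈ S.apery | w ∉ S.primitives}

theorem mem_apery : w ∈ S.apery ↔ w ∈ S.star ∧ ∀ s ∈ S, s + S.multiplicity ≠ w := by
  simp only [apery, Finset.mem_filter, Finset.mem_range, and_iff_right_iff_imp]
  rintro ⟨-, h⟩
  by_contra hc
  exact h (w - S.multiplicity) (mem_of_natConductor_le (by omega)) (by omega)

theorem lt_natConductor_add_multiplicity (hw : w ∈ S.apery) :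
    w < S.natConductor + S.multiplicity := by
  simp only [apery, Finset.mem_filter, Finset.mem_range] at hw
  exact hw.1

theorem mem_star_of_mem_apery (hw : w ∈ S.apery) : w ∈ S.star := (mem_apery.1 hw).1

theorem zero_notMem_apery (S : NumericalSemigroup) : 0 ∉ S.apery :=
  fun h => (mem_star_of_mem_apery h).2 rfl

theorem mem_of_mem_insert_zero_apery (hw : w ∈ insert 0 S.apery) : w ∈ S := by
  rcases Finset.mem_insert.1 hw with rfl | hw
  · exact zero_mem S
  · exact (mem_star_of_mem_apery hw).1

theorem multiplicity_lt_of_mem_apery (hw : w ∈ S.apery) : S.multiplicity < w := by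
  refine lt_of_le_of_ne (multiplicity_le (mem_star_of_mem_apery hw)) fun h => ?_
  exact (mem_apery.1 hw).2 0 (zero_mem S) (by omega)

theorem mem_apery_of_add_left (hx : x ∈ S.star) (hy : y ∈ S) (h : x + y ∈ S.apery) :
    x ∈ S.apery :=
  mem_apery.2 ⟨hx, fun s hs e => (mem_apery.1 h).2 (s + y) (add_mem hs hy) (by omega)⟩

theorem mem_apery_of_add_right (hx : x ∈ S) (hy : y ∈ S.star) (h : x + y ∈ S.apery) :
    y ∈ S.apery :=
  mem_apery_of_add_left hy hx (by rwa [add_comm])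

theorem mem_aperyPrimitives : w ∈ S.aperyPrimitives ↔ w ∈ S.apery ∧ w ∈ S.primitives := by
  simp only [aperyPrimitives, Finset.mem_filter]

theorem mem_decomposables : w ∈ S.decomposables ↔ w ∈ S.apery ∧ w ∉ S.primitives := by
  simp only [decomposables, Finset.mem_filter]

theorem mem_star_of_mem_aperyPrimitives (hw : w ∈ S.aperyPrimitives) : w ∈ S.star :=
  (mem_aperyPrimitives.1 hw).2.1

theorem aperyPrimitives_ne_add (hw : w ∈ S.aperyPrimitives) (hx : x ∈ S.star)
    (hy : y ∈ S.star) : w ≠ x + y :=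
  fun h => (mem_aperyPrimitives.1 hw).2.2 ⟨x, hx, y, hy, h.symm⟩

theorem add_mem_decomposables (hx : x ∈ S.star) (hy : y ∈ S.star) (h : x + y ∈ S.apery) :
    x + y ∈ S.decomposables :=
  mem_decomposables.2 ⟨h, add_notMem_primitives hx hy⟩

theorem exists_aperyPrimitive_add (hz : z ∈ S.apery) :
    ∃ t ∈ S.aperyPrimitives, ∃ r ∈ S, t + r = z := by
  obtain ⟨t, ht, r, hr, rfl⟩ := exists_primitive_add (mem_star_of_mem_apery hz)
  exact ⟨t, mem_aperyPrimitives.2 ⟨mem_apery_of_add_left ht.1 hr hz, ht⟩, r, hr, rfl⟩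

theorem exists_aperyPrimitive_add_apery (hz : z ∈ S.decomposables) :
    ∃ t ∈ S.aperyPrimitives, ∃ w ∈ S.apery, t + w = z := by
  obtain ⟨hzA, hzP⟩ := mem_decomposables.1 hz
  obtain ⟨t, ht, w, hw, rfl⟩ := exists_aperyPrimitive_add hzA
  have hw0 : w ≠ 0 := by
    rintro rfl
    exact hzP (mem_aperyPrimitives.1 ht).2
  exact ⟨t, ht, w,
    mem_apery_of_add_right (mem_star_of_mem_aperyPrimitives ht).1 ⟨hw, hw0⟩ hzA, rfl⟩

theorem sum_aperyPrimitives_add_sum_decomposables (S : NumericalSemigroup) (f : ℕ → ℕ) :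
    ∑ w ∈ S.aperyPrimitives, f w + ∑ w ∈ S.decomposables, f w = ∑ w ∈ S.apery, f w := by
  classical
  exact Finset.sum_filter_add_sum_filter_not S.apery (· ∈ S.primitives) f

theorem primitives_eq_insert (S : NumericalSemigroup) :
    S.primitives = insert S.multiplicity ↑S.aperyPrimitives := by
  ext w
  simp only [Set.mem_insert_iff, Finset.mem_coe, mem_aperyPrimitives]
  constructor
  · intro hw
    by_cases hwm : w = S.multiplicity
    · exact Or.inl hwm
    · refine Or.inr ⟨mem_apery.2 ⟨hw.1, fun s hs e => hw.2 ?_⟩, hw⟩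
      exact ⟨s, ⟨hs, by omega⟩, S.multiplicity, S.isLeast_multiplicity.1, e⟩
  · rintro (rfl | ⟨-, hw⟩)
    · refine ⟨S.isLeast_multiplicity.1, ?_⟩
      rintro ⟨x, hx, y, hy, e⟩
      have := multiplicity_le hx
      have := pos_of_mem_star hy
      omega
    · exact hw

theorem embeddingDimension_eq (S : NumericalSemigroup) :
    S.embeddingDimension = #S.aperyPrimitives + 1 := by
  rw [embeddingDimension, primitives_eq_insert, Set.ncard_insert_of_notMem, Set.ncard_coe_finset]
  intro h
  exact (multiplicity_lt_of_mem_apery (mem_aperyPrimitives.1 h).1).ne rfl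

theorem injOn_mod_multiplicity (S : NumericalSemigroup) :
    Set.InjOn (· % S.multiplicity) (insert 0 S.apery : Finset ℕ) := by
  suffices h : ∀ w ∈ insert 0 S.apery, ∀ v ∈ insert 0 S.apery,
      w % S.multiplicity = v % S.multiplicity → v ≤ w from
    fun w hw v hv e => le_antisymm (h v hv w hw e.symm) (h w hw v hv e)
  intro w hw v hv e
  by_contra! hlt
  obtain ⟨k, hk⟩ := (Nat.modEq_iff_dvd' hlt.le).1 e
  obtain ⟨j, rfl⟩ : ∃ j, k = j + 1 := Nat.exists_eq_succ_of_ne_zero fun h => by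
    rw [h, mul_zero] at hk
    omega
  have hvA : v ∈ S.apery := Finset.mem_of_mem_insert_of_ne hv (by omega)
  refine (mem_apery.1 hvA).2 (w + j * S.multiplicity)
    (add_mem (mem_of_mem_insert_zero_apery hw) (mul_mem j S.multiplicity_mem)) ?_
  rw [mul_add_one, mul_comm] at hk
  omega

theorem exists_mem_insert_zero_apery_mod_eq (S : NumericalSemigroup) {r : ℕ}
    (hr : r < S.multiplicity) : ∃ w ∈ insert 0 S.apery, w % S.multiplicity = r := by
  classical
  have hex : ∃ n, n ∈ S ∧ n % S.multiplicity = r := by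
    refine ⟨r + S.multiplicity * S.natConductor, mem_of_natConductor_le ?_, ?_⟩
    · nlinarith
    · rw [Nat.add_mul_mod_self_left, Nat.mod_eq_of_lt hr]
  obtain ⟨hmem, hmod⟩ := Nat.find_spec hex
  refine ⟨Nat.find hex, Finset.mem_insert.2 (or_iff_not_imp_left.2 fun h0 => ?_), hmod⟩
  refine mem_apery.2 ⟨⟨hmem, h0⟩, fun s hs e => ?_⟩
  refine Nat.find_min hex (m := s) (by have := S.multiplicity_pos; omega) ⟨hs, ?_⟩
  rw [← hmod, ← e, Nat.add_mod_right]

theorem card_apery (S : NumericalSemigroup) : #S.apery + 1 = S.multiplicity := by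
  rw [← Finset.card_insert_of_notMem S.zero_notMem_apery, ← Finset.card_range S.multiplicity]
  refine Finset.card_nbij (· % S.multiplicity)
    (fun w _ => by simpa using Nat.mod_lt w S.multiplicity_pos) S.injOn_mod_multiplicity
    fun r hr => ?_
  exact S.exists_mem_insert_zero_apery_mod_eq (by simpa using hr)

theorem multiplicity_eq_embeddingDimension_add (S : NumericalSemigroup) :
    S.multiplicity = S.embeddingDimension + #S.decomposables := by
  have h := S.sum_aperyPrimitives_add_sum_decomposables fun _ => 1
  simp only [Finset.sum_const, smul_eq_mul, mul_one] at h
  have := S.card_apery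
  have := S.embeddingDimension_eq
  omega

end Apery

section Level

variable {S : NumericalSemigroup} {w x y z k : ℕ}

/-- The number of elements of the class `w + m ℕ` that are smaller than the conductor, where `m` is
the multiplicity. -/
noncomputable def level (S : NumericalSemigroup) (w : ℕ) : ℕ :=
  (S.natConductor - w) ⌈/⌉ S.multiplicity

/-- The depth of `S`: its conductor divided by its multiplicity, rounded up. -/
noncomputable def depth (S : NumericalSemigroup) : ℕ := S.level 0

/-- The number of left elements charged to the Apéry element `z` in the counting argument: the
depth `q`, minus one for large `z`. The threshold is such that at most `q * m - c` Apéry elements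
are large, and that `cost_add_le` holds. -/
noncomputable def cost (S : NumericalSemigroup) (z : ℕ) : ℕ :=
  if 2 * S.natConductor + S.multiplicity ≤ z + S.depth * S.multiplicity then S.depth - 1
  else S.depth

theorem level_le_iff : S.level w ≤ k ↔ S.natConductor ≤ w + k * S.multiplicity := by
  rw [level, ceilDiv_le_iff_le_mul S.multiplicity_pos, tsub_le_iff_left, mul_comm]

theorem lt_level_iff : k < S.level w ↔ w + k * S.multiplicity < S.natConductor := by
  rw [← not_le, level_le_iff, not_le]

theorem natConductor_le_add_level_mul (S : NumericalSemigroup) (w : ℕ) :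
    S.natConductor ≤ w + S.level w * S.multiplicity :=
  level_le_iff.1 le_rfl

theorem add_level_mul_lt (h : 0 < S.level w) :
    w + S.level w * S.multiplicity < S.natConductor + S.multiplicity := by
  obtain ⟨k, hk⟩ := Nat.exists_eq_succ_of_ne_zero h.ne'
  have := lt_level_iff.1 (hk ▸ Nat.lt_succ_self k)
  rw [hk, Nat.succ_mul]
  omega

theorem natConductor_le_depth_mul (S : NumericalSemigroup) :
    S.natConductor ≤ S.depth * S.multiplicity := by
  simpa only [depth, zero_add] using S.natConductor_le_add_level_mul 0

theorem cost_le_depth (S : NumericalSemigroup) (z : ℕ) : S.cost z ≤ S.depth := by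
  unfold cost
  split_ifs <;> omega

theorem depth_le_cost_add_one (S : NumericalSemigroup) (z : ℕ) : S.depth ≤ S.cost z + 1 := by
  unfold cost
  split_ifs <;> omega

theorem one_le_level (hx : x ∈ S.star) (hy : y ∈ S.star) (h : x + y ∈ S.apery) :
    1 ≤ S.level x := by
  have := lt_natConductor_add_multiplicity h
  have := multiplicity_lt_of_mem_apery (mem_apery_of_add_right hx.1 hy h)
  exact lt_level_iff.2 (by omega)

theorem level_add_lt (hx : x ∈ S.star) (hy : y ∈ S.star) (h : x + y ∈ S.apery) :
    S.level (x + y) < S.level x := by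
  rcases Nat.eq_zero_or_pos (S.level (x + y)) with h0 | hpos
  · have := one_le_level hx hy h
    omega
  · have := add_level_mul_lt hpos
    have := multiplicity_lt_of_mem_apery (mem_apery_of_add_right hx.1 hy h)
    exact lt_level_iff.2 (by omega)

theorem cost_add_le (h : x + y ∈ S.apery) :
    S.cost (x + y) ≤ S.level x + S.level y := by
  have hlx := S.natConductor_le_add_level_mul x
  have hly := S.natConductor_le_add_level_mul y
  have hlt := lt_natConductor_add_multiplicity h
  have hq : ∀ j, S.depth ≤ j + 1 ↔ S.natConductor ≤ j * S.multiplicity + S.multiplicity := by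
    intro j
    rw [depth, level_le_iff, zero_add, add_one_mul]
  have hsum := add_mul (S.level x) (S.level y) S.multiplicity
  have hq1 : S.depth ≤ S.level x + S.level y + 1 := (hq _).2 (by omega)
  unfold cost
  split_ifs with hlarge
  · omega
  · by_contra! hgt
    have : S.depth = S.level x + S.level y + 1 := by omega
    rw [this, add_one_mul] at hlarge
    omega

theorem depth_le_level_add (h : x + y ∈ S.apery) :
    S.depth ≤ S.level x + S.level y + 1 := by
  have := S.depth_le_cost_add_one (x + y)
  have := cost_add_le h
  omega

theorem depth_add_sum_level_le (S : NumericalSemigroup) :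
    S.depth + ∑ w ∈ S.apery, S.level w ≤ S.leftPart.ncard := by
  rw [depth, ← Finset.sum_insert S.zero_notMem_apery, ← Finset.sum_congr rfl fun w _ =>
    Finset.card_range (S.level w), ← Finset.card_sigma, ← Set.ncard_coe_finset]
  refine Set.ncard_le_ncard_of_injOn (fun p => p.1 + p.2 * S.multiplicity) ?_ ?_
    S.finite_leftPart
  · rintro ⟨w, k⟩ hp
    simp only [Finset.mem_coe, Finset.mem_sigma, Finset.mem_range, lt_level_iff] at hp
    exact mem_leftPart_iff.2
      ⟨add_mem (mem_of_mem_insert_zero_apery hp.1) (mul_mem k S.multiplicity_mem), hp.2⟩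
  · rintro ⟨w, k⟩ hp ⟨v, j⟩ hp' e
    simp only [Finset.mem_coe, Finset.mem_sigma] at hp hp' e
    obtain rfl : w = v := S.injOn_mod_multiplicity hp.1 hp'.1 <| by
      simpa only [Nat.add_mul_mod_self_right] using congrArg (· % S.multiplicity) e
    obtain rfl : k = j := Nat.eq_of_mul_eq_mul_right S.multiplicity_pos (Nat.add_left_cancel e)
    rfl

open Classical in
theorem card_large_add_natConductor_le (S : NumericalSemigroup) :
    #{z ∈ S.decomposables | 2 * S.natConductor + S.multiplicity ≤ z + S.depth * S.multiplicity}
      + S.natConductor ≤ S.depth * S.multiplicity := by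
  have hq := S.natConductor_le_depth_mul
  rw [← Nat.le_sub_iff_add_le hq]
  calc _ ≤ #(Finset.Ico (2 * S.natConductor + S.multiplicity - S.depth * S.multiplicity)
        (S.natConductor + S.multiplicity)) := by
        refine Finset.card_le_card fun z hz => ?_
        obtain ⟨hz, hlarge⟩ := Finset.mem_filter.1 hz
        have := lt_natConductor_add_multiplicity (mem_decomposables.1 hz).1
        rw [Finset.mem_Ico]
        omega
    _ ≤ _ := by
        rw [Nat.card_Ico]
        omega

theorem card_decomposables_mul_depth_le (S : NumericalSemigroup) :
    #S.decomposables * S.depth + S.natConductor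
      ≤ ∑ z ∈ S.decomposables, S.cost z + S.depth * S.multiplicity := by
  classical
  have hlarge := S.card_large_add_natConductor_le
  have hcost : ∑ _ ∈ S.decomposables, S.depth ≤ ∑ z ∈ S.decomposables, (S.cost z +
      if 2 * S.natConductor + S.multiplicity ≤ z + S.depth * S.multiplicity then 1 else 0) := by
    refine Finset.sum_le_sum fun z _ => ?_
    unfold cost
    split_ifs <;> omega
  rw [Finset.sum_add_distrib, ← Finset.card_filter, Finset.sum_const, smul_eq_mul] at hcost
  omega

theorem satisfiesWilf_of_sum_cost_le
    (h : ∑ z ∈ S.decomposables, S.cost z ≤ S.embeddingDimension * ∑ w ∈ S.apery, S.level w) :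
    S.SatisfiesWilf := by
  have hleft := Nat.mul_le_mul_left S.embeddingDimension S.depth_add_sum_level_le
  have hcost := S.card_decomposables_mul_depth_le
  have hm : S.depth * S.multiplicity
      = S.embeddingDimension * S.depth + #S.decomposables * S.depth := by
    rw [S.multiplicity_eq_embeddingDimension_add]
    ring
  rw [mul_add] at hleft
  rw [satisfiesWilf_iff]
  omega

end Level

section PairSums

variable {S : NumericalSemigroup} {x y : ℕ}

/-- The total level of the pair `{x, y}`, minus the depth (truncated at `0`): what remains of the
two levels after the cost of `x + y`, which is at most the depth, has been paid. -/
noncomputable def excess (S : NumericalSemigroup) (p : Sym2 ℕ) : ℕ :=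
  (p.map S.level).add - S.depth

theorem excess_mk (S : NumericalSemigroup) (x y : ℕ) :
    S.excess s(x, y) = S.level x + S.level y - S.depth := rfl

theorem cost_add_excess_le (h : x + y ∈ S.apery) :
    S.cost (x + y) + S.excess s(x, y) ≤ S.level x + S.level y := by
  have := cost_add_le h
  have := S.cost_le_depth (x + y)
  rw [excess_mk]
  omega

theorem sum_cost_pairSums_add_sum_excess_le (S : NumericalSemigroup) :
    ∑ z ∈ S.aperyPrimitives.sym2.image Sym2.add with z ∈ S.apery, S.cost z
        + ∑ p ∈ S.aperyPrimitives.sym2, S.excess p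
      ≤ S.embeddingDimension * ∑ x ∈ S.aperyPrimitives, S.level x := by
  rw [S.embeddingDimension_eq, ← smul_eq_mul, ← sum_sym2_add_map, Finset.filter_image]
  calc _ ≤ ∑ p ∈ S.aperyPrimitives.sym2 with p.add ∈ S.apery, S.cost p.add
        + ∑ p ∈ S.aperyPrimitives.sym2, S.excess p :=
        Nat.add_le_add_right (Finset.sum_image_le_of_nonneg fun _ _ => Nat.zero_le _) _
    _ ≤ _ := by
        rw [Finset.sum_filter, ← Finset.sum_add_distrib]
        refine Finset.sum_le_sum fun p _ => ?_
        induction p with | _ x y =>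
        rw [Sym2.add_mk, Sym2.map_mk, Sym2.add_mk]
        split_ifs with h
        · exact cost_add_excess_le h
        · rw [excess_mk]
          omega

theorem sum_cost_le_of_cover (he : 3 ≤ S.embeddingDimension) {T W : Finset ℕ}
    {B : Finset (Sym2 ℕ)} (hB : B ⊆ S.aperyPrimitives.sym2) (hW : W ⊆ S.decomposables)
    (hT : S.decomposables ⊆ S.aperyPrimitives.sym2.image Sym2.add ∪ T)
    (hle : ∑ z ∈ T, S.cost z ≤ 3 * ∑ z ∈ W, S.level z + ∑ p ∈ B, S.excess p) :
    ∑ z ∈ S.decomposables, S.cost z ≤ S.embeddingDimension * ∑ w ∈ S.apery, S.level w := by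
  have hcover : S.decomposables ⊆
      {z ∈ S.aperyPrimitives.sym2.image Sym2.add | z ∈ S.apery} ∪ T := by
    intro z hz
    rw [Finset.mem_union, Finset.mem_filter]
    exact (Finset.mem_union.1 (hT hz)).imp_left fun h => ⟨h, (mem_decomposables.1 hz).1⟩
  have hdec : 3 * ∑ z ∈ W, S.level z ≤ S.embeddingDimension * ∑ z ∈ S.decomposables, S.level z :=
    Nat.mul_le_mul he (Finset.sum_le_sum_of_subset hW)
  have hexcess : ∑ p ∈ B, S.excess p ≤ ∑ p ∈ S.aperyPrimitives.sym2, S.excess p :=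
    Finset.sum_le_sum_of_subset hB
  have hpairs := S.sum_cost_pairSums_add_sum_excess_le
  rw [← sum_aperyPrimitives_add_sum_decomposables, mul_add]
  calc ∑ z ∈ S.decomposables, S.cost z
      ≤ ∑ z ∈ S.aperyPrimitives.sym2.image Sym2.add with z ∈ S.apery, S.cost z
        + ∑ z ∈ T, S.cost z :=
        (Finset.sum_le_sum_of_subset hcover).trans
          ((Nat.le_add_right _ _).trans_eq Finset.sum_union_inter)
    _ ≤ _ := by omega

end PairSums

section Multiples

variable {S : NumericalSemigroup} {n k w x y z : ℕ}

theorem two_le_level (hx : x ∈ S.star) (hy : y ∈ S.star) (hz : z ∈ S.star)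
    (h : x + y + z ∈ S.apery) : 2 ≤ S.level x := by
  have hxy := add_mem_star hx hy.1
  have := level_add_lt hx hy (mem_apery_of_add_left hxy hz.1 h)
  have := one_le_level hxy hz h
  omega

theorem mul_mem_star (hx : x ∈ S.star) (hk : k ≠ 0) : k * x ∈ S.star :=
  ⟨mul_mem k hx.1, Nat.mul_ne_zero hk hx.2⟩

theorem mul_mem_apery (hx : x ∈ S.star) (hk : k ≠ 0) (hkn : k ≤ n) (h : n * x ∈ S.apery) :
    k * x ∈ S.apery := by
  refine mem_apery_of_add_left (mul_mem_star hx hk) (mul_mem (n - k) hx.1) ?_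
  rwa [← add_mul, Nat.add_sub_cancel' hkn]

theorem one_le_level_mul (hx : x ∈ S.star) (hk : k ≠ 0) (hkn : k < n) (h : n * x ∈ S.apery) :
    1 ≤ S.level (k * x) := by
  refine one_le_level (mul_mem_star hx hk) (mul_mem_star hx (k := n - k) (by omega)) ?_
  rwa [← add_mul, Nat.add_sub_cancel' hkn.le]

theorem exists_mul_mem_apery_iff (hx : x ∈ S.star) :
    ∃ n, ∀ i, (i + 3) * x ∈ S.apery ↔ i < n := by
  classical
  have hex : ∃ n, (n + 3) * x ∉ S.apery := by
    refine ⟨S.natConductor + S.multiplicity, fun h => ?_⟩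
    have := lt_natConductor_add_multiplicity h
    have := pos_of_mem_star hx
    nlinarith
  refine ⟨Nat.find hex, fun i => ⟨fun h => ?_, fun h => not_not.1 (Nat.find_min hex h)⟩⟩
  by_contra! hle
  exact Nat.find_spec hex (mul_mem_apery hx (by omega) (by omega) h)

theorem mul_depth_le_two_mul_sum_level (h : (n + 1) * x ∈ S.apery) :
    n * S.depth ≤ 2 * ∑ i ∈ Finset.range n, S.level ((i + 1) * x) + n := by
  have hpair : ∀ i ∈ Finset.range n,
      S.depth ≤ S.level ((i + 1) * x) + S.level ((n - 1 - i + 1) * x) + 1 := by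
    intro i hi
    rw [Finset.mem_range] at hi
    refine depth_le_level_add ?_
    rwa [← add_mul, show i + 1 + (n - 1 - i + 1) = n + 1 by omega]
  have hsum := Finset.sum_le_sum hpair
  simp only [Finset.sum_add_distrib, Finset.sum_const, Finset.card_range, smul_eq_mul,
    Finset.sum_range_reflect fun i => S.level ((i + 1) * x)] at hsum
  omega

theorem add_three_le_sum_level_mul (hx : x ∈ S.star) (h : (n + 4) * x ∈ S.apery) :
    n + 3 ≤ ∑ i ∈ Finset.range (n + 2), S.level ((i + 2) * x) := by
  have htwo : 2 ≤ S.level (2 * x) := by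
    refine two_le_level (mul_mem_star hx two_ne_zero) hx hx ?_
    rw [show 2 * x + x + x = 4 * x by ring]
    exact mul_mem_apery hx four_ne_zero (by omega) h
  have hone := Finset.card_nsmul_le_sum (Finset.range (n + 1))
    (fun i => S.level ((i + 1 + 2) * x)) 1 fun i hi => by
      rw [Finset.mem_range] at hi
      exact one_le_level_mul hx (by omega) (by omega) h
  rw [Finset.sum_range_succ', zero_add]
  simp only [Finset.card_range, smul_eq_mul, mul_one] at hone
  omega

theorem sum_cost_mul_le (hx : x ∈ S.star) (hn : ∀ i, (i + 3) * x ∈ S.apery ↔ i < n) :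
    ∑ i ∈ Finset.range n, S.cost ((i + 3) * x)
      ≤ 3 * ∑ i ∈ Finset.range n, S.level ((i + 2) * x) + S.excess s(x, x) := by
  rw [excess_mk]
  match n with
  | 0 => simp
  | 1 =>
    have h3 : 2 * x + x ∈ S.apery := by
      rw [← Nat.succ_mul]
      exact (hn 0).2 one_pos
    have hx2 := mul_mem_star hx two_ne_zero
    have := cost_add_le h3
    have := S.depth_le_cost_add_one (2 * x + x)
    have := one_le_level hx2 hx h3
    simp only [Finset.sum_range_one, zero_add, show 3 * x = 2 * x + x by ring]
    omega
  | n + 2 =>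
    have hmem : (n + 4) * x ∈ S.apery := (hn (n + 1)).2 (by omega)
    have hcost : ∑ i ∈ Finset.range (n + 2), S.cost ((i + 3) * x) ≤ (n + 2) * S.depth := by
      simpa using Finset.sum_le_card_nsmul (Finset.range (n + 2)) _ _ fun i _ =>
        S.cost_le_depth ((i + 3) * x)
    have hlevel := mul_depth_le_two_mul_sum_level hmem
    have hrest := add_three_le_sum_level_mul hx hmem
    have hq : (n + 3) * S.depth = (n + 2) * S.depth + S.depth := Nat.succ_mul ..
    simp only [Finset.sum_range_succ' _ (n + 2), zero_add, one_mul, add_assoc, Nat.reduceAdd]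
      at hlevel
    omega

end Multiples

section DiagonalTriples

variable {S : NumericalSemigroup} {x z w : ℕ}

/-- The sums of three Apéry primitives that lie in the Apéry set are of the form `3 x`. Equality of
the first two summands is enough, as the summands can be permuted. -/
def DiagonalTriples (S : NumericalSemigroup) : Prop :=
  ∀ x ∈ S.aperyPrimitives, ∀ y ∈ S.aperyPrimitives, ∀ z ∈ S.aperyPrimitives,
    x + y + z ∈ S.apery → x = y

theorem exists_triple_add_of_notMem_pairSums (hz : z ∈ S.decomposables)
    (hpair : z ∉ S.aperyPrimitives.sym2.image Sym2.add) :
    ∃ t ∈ S.aperyPrimitives, ∃ s ∈ S.aperyPrimitives, ∃ r ∈ S.aperyPrimitives, ∃ w ∈ S,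
      t + s + r + w = z := by
  obtain ⟨t, ht, v, hv, rfl⟩ := exists_aperyPrimitive_add_apery hz
  have hvP : v ∉ S.primitives := fun h => hpair <| Finset.mem_image.2
    ⟨s(t, v), Finset.mk_mem_sym2_iff.2 ⟨ht, mem_aperyPrimitives.2 ⟨hv, h⟩⟩, rfl⟩
  obtain ⟨s, hs, u, hu, rfl⟩ :=
    exists_aperyPrimitive_add_apery (mem_decomposables.2 ⟨hv, hvP⟩)
  obtain ⟨r, hr, w, hw, rfl⟩ := exists_aperyPrimitive_add hu
  exact ⟨t, ht, s, hs, r, hr, w, hw, by ring⟩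

namespace DiagonalTriples

variable (hS : S.DiagonalTriples)
include hS

theorem exists_eq_mul (hx : x ∈ S.aperyPrimitives) (hw : w ∈ S)
    (h : x + x + w ∈ S.apery) : ∃ k, w = k * x := by
  induction w using Nat.strong_induction_on with
  | _ w ih =>
    rcases eq_or_ne w 0 with rfl | hw0
    · exact ⟨0, (zero_mul x).symm⟩
    have hx' := mem_star_of_mem_aperyPrimitives hx
    have hxx := add_mem hx'.1 hx'.1
    obtain ⟨t, ht, r, hr, rfl⟩ :=
      exists_aperyPrimitive_add (mem_apery_of_add_right hxx ⟨hw, hw0⟩ h)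
    rw [← add_assoc] at h
    have ht' := mem_star_of_mem_aperyPrimitives ht
    have hxtx : x + t + x ∈ S.apery := by
      rw [add_right_comm]
      exact mem_apery_of_add_left (add_mem_star (add_mem_star hx' hx'.1) ht'.1) hr h
    obtain rfl := hS x hx t ht x hx hxtx
    obtain ⟨k, rfl⟩ := ih r (by have := pos_of_mem_star hx'; omega) hr
      (mem_apery_of_add_left (add_mem_star (add_mem_star hx' hx'.1) hr) hx'.1
        (by rwa [add_right_comm]))
    exact ⟨k + 1, by ring⟩

theorem exists_eq_mul_of_notMem_pairSums (hz : z ∈ S.decomposables)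
    (hpair : z ∉ S.aperyPrimitives.sym2.image Sym2.add) :
    ∃ x ∈ S.aperyPrimitives, ∃ i, z = (i + 3) * x := by
  obtain ⟨t, ht, s, hs, r, hr, w, hw, rfl⟩ := exists_triple_add_of_notMem_pairSums hz hpair
  have hzA := (mem_decomposables.1 hz).1
  have ht' := mem_star_of_mem_aperyPrimitives ht
  have hs' := mem_star_of_mem_aperyPrimitives hs
  have hr' := mem_star_of_mem_aperyPrimitives hr
  have htriple : t + s + r ∈ S.apery :=
    mem_apery_of_add_left (add_mem_star (add_mem_star ht' hs'.1) hr'.1) hw hzA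
  obtain rfl := hS t ht s hs r hr htriple
  obtain rfl := hS t ht r hr t ht (by rwa [add_right_comm])
  obtain ⟨k, rfl⟩ := hS.exists_eq_mul ht hw <|
    mem_apery_of_add_left (add_mem_star (add_mem_star ht' ht'.1) hw) ht'.1 (by rwa [add_right_comm])
  exact ⟨t, ht, k, by ring⟩

theorem injOn_mul {n : ℕ → ℕ}
    (hn : ∀ x ∈ S.aperyPrimitives, ∀ i, (i + 3) * x ∈ S.apery ↔ i < n x) :
    Set.InjOn (fun p : Σ _ : ℕ, ℕ => (p.2 + 2) * p.1)
      (S.aperyPrimitives.sigma fun x => Finset.range (n x)) := by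
  rintro ⟨x, i⟩ hp ⟨y, j⟩ hp' e
  simp only [Finset.mem_coe, Finset.mem_sigma, Finset.mem_range] at hp hp' e
  have hx := mem_star_of_mem_aperyPrimitives hp.1
  have hy := mem_star_of_mem_aperyPrimitives hp'.1
  have hxi : y + x + y + j * y ∈ S.apery := by
    rw [show y + x + y + j * y = (j + 2) * y + x by ring, ← e, ← Nat.succ_mul]
    exact (hn x hp.1 i).2 hp.2
  obtain rfl : y = x := hS y hp'.1 x hp.1 y hp'.1 <|
    mem_apery_of_add_left (add_mem_star (add_mem_star hy hx.1) hy.1) (mul_mem j hy.1) hxi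
  obtain rfl : i = j := by
    have := Nat.eq_of_mul_eq_mul_right (pos_of_mem_star hx) e
    omega
  rfl

theorem sum_cost_le (he : 3 ≤ S.embeddingDimension) :
    ∑ z ∈ S.decomposables, S.cost z ≤ S.embeddingDimension * ∑ w ∈ S.apery, S.level w := by
  have hstar : ∀ x ∈ S.aperyPrimitives, x ∈ S.star := fun x => mem_star_of_mem_aperyPrimitives
  choose! n hn using fun x hx => exists_mul_mem_apery_iff (hstar x hx)
  set E := S.aperyPrimitives.sigma fun x => Finset.range (n x) with hE
  refine sum_cost_le_of_cover he (T := E.image fun p => (p.2 + 3) * p.1)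
    (W := E.image fun p => (p.2 + 2) * p.1) (B := S.aperyPrimitives.image Sym2.diag)
    (Finset.image_subset_iff.2 fun x hx => Finset.mk_mem_sym2_iff.2 ⟨hx, hx⟩) ?_ ?_ ?_
  · refine Finset.image_subset_iff.2 fun ⟨x, i⟩ hp => ?_
    obtain ⟨hx, hi⟩ := Finset.mem_sigma.1 hp
    have hA : (i + 2) * x ∈ S.apery := mul_mem_apery (hstar x hx) (by omega) (Nat.le_succ _)
      ((hn x hx i).2 (Finset.mem_range.1 hi))
    have hsum : (i + 2) * x = (i + 1) * x + x := Nat.succ_mul ..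
    rw [hsum] at hA ⊢
    exact add_mem_decomposables (mul_mem_star (hstar x hx) (by omega)) (hstar x hx) hA
  · refine fun z hz => Finset.mem_union.2 (or_iff_not_imp_left.2 fun hpair => ?_)
    obtain ⟨x, hx, i, rfl⟩ := hS.exists_eq_mul_of_notMem_pairSums hz hpair
    exact Finset.mem_image.2 ⟨⟨x, i⟩, Finset.mem_sigma.2
      ⟨hx, Finset.mem_range.2 ((hn x hx i).1 (mem_decomposables.1 hz).1)⟩, rfl⟩
  · rw [Finset.sum_image (hS.injOn_mul hn), Finset.sum_image Sym2.diag_injective.injOn]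
    calc _ ≤ ∑ p ∈ E, S.cost ((p.2 + 3) * p.1) :=
          Finset.sum_image_le_of_nonneg fun _ _ => Nat.zero_le _
      _ ≤ _ := by
          rw [hE, Finset.sum_sigma, Finset.sum_sigma, Finset.mul_sum, ← Finset.sum_add_distrib]
          exact Finset.sum_le_sum fun x hx => sum_cost_mul_le (hstar x hx) (hn x hx)

end DiagonalTriples

end DiagonalTriples

section MixedTriple

variable {S : NumericalSemigroup} {x y u v t z : ℕ}

theorem add_add_notMem_apery (hL : ∑ w ∈ S.apery, S.level w < 2 * S.depth)
    (hx : x ∈ S.aperyPrimitives) (hu : u ∈ S.aperyPrimitives) (hv : v ∈ S.aperyPrimitives)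
    (hxu : x ≠ u) (hxv : x ≠ v) (huv : u ≠ v) : x + u + v ∉ S.apery := by
  intro h₁
  have hx' := mem_star_of_mem_aperyPrimitives hx
  have hu' := mem_star_of_mem_aperyPrimitives hu
  have hv' := mem_star_of_mem_aperyPrimitives hv
  have h₂ : x + v + u ∈ S.apery := by rwa [add_right_comm]
  have h₃ : u + v + x ∈ S.apery := by rwa [add_comm, ← add_assoc]
  have hxu' := add_mem_star hx' hu'.1
  have hxv' := add_mem_star hx' hv'.1
  have huv' := add_mem_star hu' hv'.1
  have hne : ∀ p ∈ S.aperyPrimitives, p ≠ x + u ∧ p ≠ x + v ∧ p ≠ u + v := fun p hp =>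
    ⟨aperyPrimitives_ne_add hp hx' hu', aperyPrimitives_ne_add hp hx' hv',
      aperyPrimitives_ne_add hp hu' hv'⟩
  have hxne := hne x hx
  have hune := hne u hu
  have hvne := hne v hv
  have hsum := sum_map_le_sum_of_nodup (s := S.apery) (l := [x, u, v, x + u, x + v, u + v])
    (by simp; omega)
    (by
      simp only [List.forall_mem_cons, List.not_mem_nil, IsEmpty.forall_iff, implies_true]
      exact ⟨(mem_aperyPrimitives.1 hx).1, (mem_aperyPrimitives.1 hu).1,
        (mem_aperyPrimitives.1 hv).1, mem_apery_of_add_left hxu' hv'.1 h₁,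
        mem_apery_of_add_left hxv' hu'.1 h₂, mem_apery_of_add_left huv' hx'.1 h₃, trivial⟩)
    S.level
  simp only [List.map_cons, List.map_nil, List.sum_cons, List.sum_nil] at hsum
  have := depth_le_level_add h₁
  have := depth_le_level_add h₂
  have := two_le_level hx' hu' hv' h₁
  omega

/-- Two distinct Apéry primitives `x` and `u` such that `2 u + x` lies in the Apéry set. -/
structure MixedTriple (S : NumericalSemigroup) (x u : ℕ) : Prop where
  left_mem : x ∈ S.aperyPrimitives
  right_mem : u ∈ S.aperyPrimitives
  ne : x ≠ u
  double_add_mem : u + u + x ∈ S.apery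

theorem exists_mixedTriple (hL : ∑ w ∈ S.apery, S.level w < 2 * S.depth)
    (hS : ¬ S.DiagonalTriples) : ∃ x u, S.MixedTriple x u := by
  simp only [DiagonalTriples, not_forall] at hS
  obtain ⟨x, hx, u, hu, v, hv, h, hxu⟩ := hS
  rcases eq_or_ne x v with rfl | hxv
  · exact ⟨u, x, hu, hx, Ne.symm hxu, by rwa [add_right_comm]⟩
  rcases eq_or_ne u v with rfl | huv
  · exact ⟨x, u, hx, hu, hxu, by rwa [add_comm, ← add_assoc, add_right_comm] at h⟩
  · exact absurd h (add_add_notMem_apery hL hx hu hv hxu hxv huv)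

namespace MixedTriple

/-- The nonzero proper partial sums of `u + u + x`. -/
def partialSums (x u : ℕ) : Finset ℕ := {x, u, u + u, x + u}

variable (h : S.MixedTriple x u)
include h

theorem left_mem_star : x ∈ S.star := mem_star_of_mem_aperyPrimitives h.left_mem

theorem right_mem_star : u ∈ S.star := mem_star_of_mem_aperyPrimitives h.right_mem

theorem sum_add_mem : x + u + u ∈ S.apery := by
  rw [add_assoc, add_comm]
  exact h.double_add_mem

theorem double_mem_star : u + u ∈ S.star := add_mem_star h.right_mem_star h.right_mem_star.1

theorem sum_mem_star : x + u ∈ S.star := add_mem_star h.left_mem_star h.right_mem_star.1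

theorem double_mem_apery : u + u ∈ S.apery :=
  mem_apery_of_add_left h.double_mem_star h.left_mem_star.1 h.double_add_mem

theorem sum_mem_apery : x + u ∈ S.apery :=
  mem_apery_of_add_left h.sum_mem_star h.right_mem_star.1 h.sum_add_mem

theorem depth_le_left : S.depth ≤ S.level x + S.level (u + u) + 1 := by
  have := depth_le_level_add h.double_add_mem
  omega

theorem depth_le_right : S.depth ≤ S.level u + S.level (x + u) + 1 := by
  have := depth_le_level_add h.sum_add_mem
  omega

theorem one_le_level_double : 1 ≤ S.level (u + u) :=
  one_le_level h.double_mem_star h.left_mem_star h.double_add_mem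

theorem one_le_level_sum : 1 ≤ S.level (x + u) :=
  one_le_level h.sum_mem_star h.right_mem_star h.sum_add_mem

theorem partialSums_subset : partialSums x u ⊆ S.apery := by
  simp only [partialSums, Finset.insert_subset_iff, Finset.singleton_subset_iff]
  exact ⟨(mem_aperyPrimitives.1 h.left_mem).1, (mem_aperyPrimitives.1 h.right_mem).1,
    h.double_mem_apery, h.sum_mem_apery⟩

theorem sum_level_partialSums : ∑ w ∈ partialSums x u, S.level w =
    (S.level x + S.level (u + u)) + (S.level u + S.level (x + u)) := by
  have hx := h.left_mem_star
  have hu := h.right_mem_star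
  have := aperyPrimitives_ne_add h.left_mem hu hu
  have := aperyPrimitives_ne_add h.right_mem hu hu
  have := aperyPrimitives_ne_add h.right_mem hx hu
  have := h.ne
  rw [partialSums, Finset.sum_insert, Finset.sum_insert, Finset.sum_pair (by omega)]
  · omega
  all_goals
    simp only [Finset.mem_insert, Finset.mem_singleton]
    omega

theorem eq_or_eq_of_mem_partialSums (ht : t ∈ S.aperyPrimitives) (h' : t ∈ partialSums x u) :
    t = x ∨ t = u := by
  simp only [partialSums, Finset.mem_insert, Finset.mem_singleton] at h'
  have := aperyPrimitives_ne_add ht h.right_mem_star h.right_mem_star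
  have := aperyPrimitives_ne_add ht h.left_mem_star h.right_mem_star
  tauto

theorem sum_level_le {E : Finset ℕ} (hE : E ⊆ S.apery) (hdisj : Disjoint E (partialSums x u)) :
    ∑ w ∈ E, S.level w + ((S.level x + S.level (u + u)) + (S.level u + S.level (x + u)))
      ≤ ∑ w ∈ S.apery, S.level w := by
  rw [← h.sum_level_partialSums, ← Finset.sum_union hdisj]
  exact Finset.sum_le_sum_of_subset (Finset.union_subset hE h.partialSums_subset)

theorem mem_partialSums_of_two_le_level (hL : ∑ w ∈ S.apery, S.level w < 2 * S.depth)
    (hz : z ∈ S.apery) (hz2 : 2 ≤ S.level z) : z ∈ partialSums x u := by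
  by_contra hnot
  have := h.sum_level_le (Finset.singleton_subset_iff.2 hz) (Finset.disjoint_singleton_left.2 hnot)
  rw [Finset.sum_singleton] at this
  have := h.depth_le_left
  have := h.depth_le_right
  omega

end MixedTriple

end MixedTriple

section ExtendedTriple

variable {S : NumericalSemigroup} {s t u v x y z : ℕ}

theorem sum_cost_le_of_card_le_three (he : 3 ≤ S.embeddingDimension)
    (hD : #S.decomposables ≤ 2 * S.embeddingDimension)
    (hL : ∑ w ∈ S.apery, S.level w + 1 = 2 * S.depth) {K : Finset ℕ} (hK : #K ≤ 3)
    (hcost : ∀ z ∈ S.decomposables, z ∉ K → S.cost z < S.depth) :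
    ∑ z ∈ S.decomposables, S.cost z ≤ S.embeddingDimension * ∑ w ∈ S.apery, S.level w := by
  obtain ⟨q, hq⟩ : ∃ q, S.depth = q + 1 := Nat.exists_eq_succ_of_ne_zero (by omega)
  have hcostK : ∀ z ∈ S.decomposables, S.cost z ≤ q + if z ∈ K then 1 else 0 := by
    intro z hz
    have := S.cost_le_depth z
    split_ifs with hzK
    · omega
    · have := hcost z hz hzK
      omega
  have hsum := Finset.sum_le_sum hcostK
  rw [Finset.sum_add_distrib, ← Finset.card_filter, Finset.sum_const, smul_eq_mul] at hsum
  have hfilter : #{z ∈ S.decomposables | z ∈ K} ≤ 3 :=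
    (Finset.card_le_card fun z hz => (Finset.mem_filter.1 hz).2).trans hK
  obtain hL' : ∑ w ∈ S.apery, S.level w = 2 * q + 1 := by omega
  calc ∑ z ∈ S.decomposables, S.cost z ≤ 2 * S.embeddingDimension * q + 3 :=
        hsum.trans (Nat.add_le_add (Nat.mul_le_mul_right q hD) hfilter)
    _ ≤ S.embeddingDimension * ∑ w ∈ S.apery, S.level w := by
        rw [hL', mul_add_one, ← mul_assoc, mul_comm S.embeddingDimension 2]
        omega

namespace MixedTriple

theorem eq_or_eq_of_add_add_mem_apery (h : S.MixedTriple x u)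
    (hL : ∑ w ∈ S.apery, S.level w < 2 * S.depth) (ht : t ∈ S.aperyPrimitives)
    (hy : y ∈ S.star) (hz : z ∈ S.star) (hA : t + y + z ∈ S.apery) : t = x ∨ t = u := by
  refine h.eq_or_eq_of_mem_partialSums ht (h.mem_partialSums_of_two_le_level hL ?_ ?_)
  · exact (mem_aperyPrimitives.1 ht).1
  · exact two_le_level (mem_star_of_mem_aperyPrimitives ht) hy hz hA

theorem exists_eq_or_eq_add (h : S.MixedTriple x u)
    (hL : ∑ w ∈ S.apery, S.level w < 2 * S.depth) (hy : y ∈ S.star) (hz : z ∈ S.star)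
    (hv : v ∈ S.star) (hA : y + z + v ∈ S.apery) :
    ∃ t r, (t = x ∨ t = u) ∧ r ∈ S ∧ t + r = v := by
  have hyz := add_mem hy.1 hz.1
  obtain ⟨t, ht, r, hr, rfl⟩ := exists_aperyPrimitive_add (mem_apery_of_add_right hyz hv hA)
  have ht' := mem_star_of_mem_aperyPrimitives ht
  refine ⟨t, r, h.eq_or_eq_of_add_add_mem_apery hL ht hy hz ?_, hr, rfl⟩
  refine mem_apery_of_add_left (add_mem_star (add_mem_star ht' hy.1) hz.1) hr ?_
  rwa [show t + y + z + r = y + z + (t + r) by ring]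

theorem eq_of_notMem_pairSums (h : S.MixedTriple x u)
    (hL : ∑ w ∈ S.apery, S.level w < 2 * S.depth) (hxx : ∀ v ∈ S.star, x + x + v ∉ S.apery)
    (huuu : ∀ v ∈ S.star, u + u + u + v ∉ S.apery) (hz : z ∈ S.decomposables)
    (hpair : z ∉ S.aperyPrimitives.sym2.image Sym2.add) : z = u + u + u ∨ z = u + u + x := by
  have hzA := (mem_decomposables.1 hz).1
  obtain ⟨t, ht, s, hs, r, hr, w, hw, e⟩ := exists_triple_add_of_notMem_pairSums hz hpair
  have ht' := mem_star_of_mem_aperyPrimitives ht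
  have hs' := mem_star_of_mem_aperyPrimitives hs
  have hr' := mem_star_of_mem_aperyPrimitives hr
  have hx := h.left_mem_star
  have htriple := mem_apery_of_add_left (add_mem_star (add_mem_star ht' hs'.1) hr'.1) hw (e ▸ hzA)
  have htxu := h.eq_or_eq_of_add_add_mem_apery hL ht hs' hr' htriple
  have hsxu := h.eq_or_eq_of_add_add_mem_apery hL hs ht' hr' (by rwa [add_comm s t])
  have hrxu := h.eq_or_eq_of_add_add_mem_apery hL hr ht' hs' (by rwa [add_assoc, add_comm])
  have hxx' : ∀ a ∈ S.star, ∀ b ∈ S, x + x + a + b ≠ z := fun a ha b hb hab =>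
    hxx (a + b) (add_mem_star ha hb) (by rwa [← add_assoc, hab])
  have ht := hxx' t ht' w hw
  have hs := hxx' s hs' w hw
  have hr := hxx' r hr' w hw
  have hzw : z = u + u + u + w ∨ z = x + u + u + w := by omega
  rcases eq_or_ne w 0 with rfl | hw0
  · omega
  obtain ⟨p, b, hp, hb, rfl⟩ := h.exists_eq_or_eq_add hL (add_mem_star ht' hs'.1) hr'
    ⟨hw, hw0⟩ (e ▸ hzA)
  rcases hzw with rfl | rfl
  · exact absurd hzA (huuu _ ⟨hw, hw0⟩)
  rcases hp with rfl | rfl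
  · exact absurd (by ring) (hxx' (u + u) h.double_mem_star b hb)
  · refine absurd hzA ?_
    rw [show x + p + p + (p + b) = p + p + p + (x + b) by ring]
    exact huuu (x + b) (add_mem_star hx hb)

theorem sum_cost_le_of_notMem (h : S.MixedTriple x u) (he : 3 ≤ S.embeddingDimension)
    (hL : ∑ w ∈ S.apery, S.level w < 2 * S.depth) (hxx : ∀ v ∈ S.star, x + x + v ∉ S.apery)
    (huuu : ∀ v ∈ S.star, u + u + u + v ∉ S.apery) :
    ∑ z ∈ S.decomposables, S.cost z ≤ S.embeddingDimension * ∑ w ∈ S.apery, S.level w := by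
  classical
  have hx := h.left_mem_star
  have hu := h.right_mem_star
  have hne := h.ne
  refine sum_cost_le_of_cover he (T := {z ∈ {u + u + u, u + u + x} | z ∈ S.apery})
    (W := {u + u, x + u}) (B := {s(u, u), s(x, u)}) ?_ ?_ ?_ ?_
  · simp only [Finset.insert_subset_iff, Finset.singleton_subset_iff, Finset.mk_mem_sym2_iff]
    exact ⟨⟨h.right_mem, h.right_mem⟩, h.left_mem, h.right_mem⟩
  · simp only [Finset.insert_subset_iff, Finset.singleton_subset_iff]
    exact ⟨add_mem_decomposables hu hu h.double_mem_apery,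
      add_mem_decomposables hx hu h.sum_mem_apery⟩
  · refine fun z hz => Finset.mem_union.2 (or_iff_not_imp_left.2 fun hpair => ?_)
    rw [Finset.mem_filter, Finset.mem_insert, Finset.mem_singleton]
    exact ⟨h.eq_of_notMem_pairSums hL hxx huuu hz hpair, (mem_decomposables.1 hz).1⟩
  · have hpair : s(u, u) ≠ s(x, u) := fun e => hne.symm (Sym2.congr_left.1 e)
    rw [Finset.sum_filter, Finset.sum_pair (by omega), if_pos h.double_add_mem,
      Finset.sum_pair (by omega), Finset.sum_pair hpair, excess_mk, excess_mk]
    have := h.depth_le_right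
    have := h.one_le_level_double
    have := h.one_le_level_sum
    have := cost_add_le h.double_add_mem
    split_ifs with huuuA
    · have := S.cost_le_depth (u + u + u)
      have := cost_add_le huuuA
      omega
    · omega

end MixedTriple

/-- A mixed triple together with one further decomposable Apéry element `y` of positive level,
outside the partial sums of the triple, when the total level is less than twice the depth. The
total level is then exhausted by `y` and the partial sums, and the bounds on it are tight. -/
structure ExtendedTriple (S : NumericalSemigroup) (x u y : ℕ) : Prop
    extends S.MixedTriple x u where
  sum_level_lt : ∑ w ∈ S.apery, S.level w < 2 * S.depth
  extra_mem : y ∈ S.decomposables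
  extra_notMem : y ∉ MixedTriple.partialSums x u
  one_le_level_extra : 1 ≤ S.level y

namespace ExtendedTriple

variable (h : S.ExtendedTriple x u y)
include h

theorem extra_mem_apery : y ∈ S.apery := (mem_decomposables.1 h.extra_mem).1

theorem level_add_sum_level_partialSums_le :
    S.level y + ((S.level x + S.level (u + u)) + (S.level u + S.level (x + u)))
      ≤ ∑ w ∈ S.apery, S.level w := by
  have := h.sum_level_le
    (Finset.singleton_subset_iff.2 h.extra_mem_apery)
    (Finset.disjoint_singleton_left.2 h.extra_notMem)
  rwa [Finset.sum_singleton] at this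

theorem level_eqs : S.level y = 1 ∧ S.level x + S.level (u + u) + 1 = S.depth ∧
    S.level u + S.level (x + u) + 1 = S.depth ∧
    ∑ w ∈ S.apery, S.level w + 1 = 2 * S.depth := by
  have := h.level_add_sum_level_partialSums_le
  have := h.sum_level_lt
  have := h.depth_le_left
  have := h.depth_le_right
  have := h.one_le_level_extra
  omega

theorem mem_insert_partialSums (hz : z ∈ S.apery) (hz1 : 1 ≤ S.level z) :
    z ∈ insert y (MixedTriple.partialSums x u) := by
  by_contra! hnot
  obtain ⟨hzy, hzW⟩ := not_or.1 (Finset.mem_insert.not.1 hnot)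
  have hle := h.sum_level_le (E := {y, z})
    (by
      rw [Finset.insert_subset_iff, Finset.singleton_subset_iff]
      exact ⟨h.extra_mem_apery, hz⟩)
    (by
      rw [Finset.disjoint_insert_left, Finset.disjoint_singleton_left]
      exact ⟨h.extra_notMem, hzW⟩)
  rw [Finset.sum_pair (Ne.symm hzy)] at hle
  have := h.sum_level_lt
  have := h.depth_le_left
  have := h.depth_le_right
  have := h.one_le_level_extra
  omega

theorem exists_add_eq (hz : z ∈ S.decomposables) :
    ∃ t w, (t = x ∨ t = u) ∧ (w = y ∨ w = x ∨ w = u ∨ w = u + u ∨ w = x + u) ∧ t + w = z := by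
  obtain ⟨t, ht, w, hw, rfl⟩ := exists_aperyPrimitive_add_apery hz
  have hzA := (mem_decomposables.1 hz).1
  have ht' := mem_star_of_mem_aperyPrimitives ht
  have hw' := mem_star_of_mem_apery hw
  have htW := h.mem_insert_partialSums (mem_aperyPrimitives.1 ht).1
    (one_le_level ht' hw' hzA)
  have hwW := h.mem_insert_partialSums hw
    (one_le_level hw' ht' (by rwa [add_comm]))
  have hty : t ≠ y := by
    rintro rfl
    exact (mem_decomposables.1 h.extra_mem).2 (mem_aperyPrimitives.1 ht).2
  refine ⟨t, w, h.eq_or_eq_of_mem_partialSums ht (Finset.mem_of_mem_insert_of_ne htW hty), ?_, rfl⟩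
  simpa only [MixedTriple.partialSums, Finset.mem_insert, Finset.mem_singleton] using hwW

theorem cost_double_add_lt : S.cost (u + u + x) < S.depth := by
  have := cost_add_le h.double_add_mem
  have := h.level_eqs.2.1
  omega

theorem level_left_add_two_le : S.level x + 2 ≤ S.depth := by
  have := h.level_eqs
  have := h.one_le_level_double
  omega

theorem level_right_add_two_le : S.level u + 2 ≤ S.depth := by
  have := h.level_eqs
  have := h.one_le_level_sum
  omega

theorem cost_add_extra_lt (hlevel : S.level t + 2 ≤ S.depth) (hA : t + y ∈ S.apery) :
    S.cost (t + y) < S.depth := by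
  have := cost_add_le hA
  have := h.level_eqs
  omega

end ExtendedTriple

namespace MixedTriple

variable (h : S.MixedTriple x u)
include h

theorem left_double_notMem_partialSums : x + x ∉ partialSums x u := by
  have hx := h.left_mem_star
  have := aperyPrimitives_ne_add h.right_mem hx hx
  have := pos_of_mem_star hx
  have := h.ne
  simp only [partialSums, Finset.mem_insert, Finset.mem_singleton]
  omega

theorem right_triple_notMem_partialSums : u + u + u ∉ partialSums x u := by
  have := aperyPrimitives_ne_add h.left_mem h.double_mem_star h.right_mem_star
  have := aperyPrimitives_ne_add h.left_mem h.right_mem_star h.right_mem_star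
  have := pos_of_mem_star h.right_mem_star
  simp only [partialSums, Finset.mem_insert, Finset.mem_singleton]
  omega

theorem extendedTriple_left_double (hL : ∑ w ∈ S.apery, S.level w < 2 * S.depth)
    (hv : v ∈ S.star) (hA : x + x + v ∈ S.apery) : S.ExtendedTriple x u (x + x) := by
  have hx := h.left_mem_star
  have hxx := add_mem_star hx hx.1
  exact ⟨h, hL, add_mem_decomposables hx hx (mem_apery_of_add_left hxx hv.1 hA),
    h.left_double_notMem_partialSums, one_le_level hxx hv hA⟩

theorem extendedTriple_right_triple (hL : ∑ w ∈ S.apery, S.level w < 2 * S.depth)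
    (hv : v ∈ S.star) (hA : u + u + u + v ∈ S.apery) : S.ExtendedTriple x u (u + u + u) := by
  have hu := h.right_mem_star
  have huuu := add_mem_star h.double_mem_star hu.1
  exact ⟨h, hL, add_mem_decomposables h.double_mem_star hu (mem_apery_of_add_left huuu hv.1 hA),
    h.right_triple_notMem_partialSums, one_le_level huuu hv hA⟩

end MixedTriple

namespace ExtendedTriple

theorem level_right_le_level_left (h : S.ExtendedTriple x u (x + x)) (hv : v ∈ S.star)
    (hA : x + x + v ∈ S.apery) : S.level u ≤ S.level x := by
  have hx := h.left_mem_star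
  have hxx := add_mem_star hx hx.1
  have hlevels := h.level_eqs
  have hbound := h.level_right_add_two_le
  obtain ⟨p, r, hp, hr, rfl⟩ := h.exists_eq_or_eq_add h.sum_level_lt hx hx hv hA
  rcases hp with rfl | rfl
  · have := depth_le_level_add (mem_apery_of_add_left (add_mem_star hxx hx.1) hr
      (by rwa [add_assoc (p + p)]))
    omega
  · have hxxu : x + (x + p) ∈ S.apery := by
      refine mem_apery_of_add_left (add_mem_star hx h.sum_mem_star.1) hr ?_
      rwa [show x + (x + p) + r = x + x + (p + r) by ring]
    have := depth_le_level_add hxxu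
    omega

theorem cost_lt_of_left_double (h : S.ExtendedTriple x u (x + x)) (hv : v ∈ S.star)
    (hA : x + x + v ∈ S.apery) (hz : z ∈ S.decomposables) (hzx : z ≠ x + x) (hzu : z ≠ u + u)
    (hzxu : z ≠ x + u) : S.cost z < S.depth := by
  have hzA := (mem_decomposables.1 hz).1
  obtain ⟨t, w, ht, hw, e⟩ := h.exists_add_eq hz
  obtain rfl | rfl | rfl | rfl :
      z = x + (x + x) ∨ z = u + (x + x) ∨ z = u + u + x ∨ z = u + u + u := by omega
  · exact h.cost_add_extra_lt h.level_left_add_two_le hzA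
  · exact h.cost_add_extra_lt h.level_right_add_two_le hzA
  · exact h.cost_double_add_lt
  · have := cost_add_le hzA
    have := h.level_right_le_level_left hv hA
    have := h.level_eqs
    omega

theorem right_triple_add_left_notMem (h : S.ExtendedTriple x u (u + u + u)) :
    u + u + u + x ∉ S.apery := by
  intro hA
  have hx := h.left_mem_star
  have hu := h.right_mem_star
  have := h.mem_insert_partialSums h.double_add_mem <|
    one_le_level (add_mem_star h.double_mem_star hx.1) hu (by rwa [add_right_comm])
  simp only [MixedTriple.partialSums, Finset.mem_insert, Finset.mem_singleton] at this
  have := pos_of_mem_star hx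
  have := pos_of_mem_star hu
  have := h.ne
  omega

theorem depth_le_two_mul_level_double (h : S.ExtendedTriple x u (u + u + u)) (hv : v ∈ S.star)
    (hA : u + u + u + v ∈ S.apery) : S.depth ≤ 2 * S.level (u + u) + 1 := by
  have hu := h.right_mem_star
  have huu := h.double_mem_star
  have huuu := add_mem_star huu hu.1
  obtain ⟨p, r, hp, hr, rfl⟩ := h.exists_eq_or_eq_add h.sum_level_lt huu hu hv hA
  have hp' : p ∈ S.star := by
    rcases hp with rfl | rfl
    exacts [h.left_mem_star, hu]
  have hpA : u + u + u + p ∈ S.apery :=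
    mem_apery_of_add_left (add_mem_star huuu hp'.1) hr (by rwa [add_assoc (u + u + u)])
  rcases hp with rfl | rfl
  · exact absurd hpA h.right_triple_add_left_notMem
  · have := depth_le_level_add (x := p + p) (y := p + p) (by rwa [← add_assoc])
    omega

theorem left_double_eq (h : S.ExtendedTriple x u (u + u + u)) (hA : u + (x + x) ∈ S.apery) :
    x + x = u + u + u := by
  have hx := h.left_mem_star
  have hu := h.right_mem_star
  have hxx := add_mem_star hx hx.1
  have := h.mem_insert_partialSums (mem_apery_of_add_right hu.1 hxx hA)
    (one_le_level hxx hu (by rwa [add_comm]))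
  exact (Finset.mem_insert.1 this).resolve_right h.left_double_notMem_partialSums

theorem cost_lt_of_right_triple (h : S.ExtendedTriple x u (u + u + u)) (hv : v ∈ S.star)
    (hA : u + u + u + v ∈ S.apery) (hz : z ∈ S.decomposables) (hzu : z ≠ u + u)
    (hzxu : z ≠ x + u) (hzuuu : z ≠ u + u + u) : S.cost z < S.depth := by
  have hzA := (mem_decomposables.1 hz).1
  obtain ⟨t, w, ht, hw, e⟩ := h.exists_add_eq hz
  obtain rfl | rfl | rfl | rfl | rfl : z = x + x ∨ z = u + (x + x) ∨ z = u + u + x ∨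
      z = u + u + u + x ∨ z = u + (u + u + u) := by omega
  · have := cost_add_le hzA
    have := h.depth_le_two_mul_level_double hv hA
    have := h.level_eqs
    omega
  · have hxx := h.left_double_eq hzA
    rw [hxx] at hzA ⊢
    exact h.cost_add_extra_lt h.level_right_add_two_le hzA
  · exact h.cost_double_add_lt
  · exact absurd hzA h.right_triple_add_left_notMem
  · exact h.cost_add_extra_lt h.level_right_add_two_le hzA

end ExtendedTriple

theorem MixedTriple.sum_cost_le (h : S.MixedTriple x u) (he : 3 ≤ S.embeddingDimension)
    (hD : #S.decomposables ≤ 2 * S.embeddingDimension)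
    (hL : ∑ w ∈ S.apery, S.level w < 2 * S.depth) :
    ∑ z ∈ S.decomposables, S.cost z ≤ S.embeddingDimension * ∑ w ∈ S.apery, S.level w := by
  by_cases hxx : ∃ v ∈ S.star, x + x + v ∈ S.apery
  · obtain ⟨v, hv, hA⟩ := hxx
    have hext := h.extendedTriple_left_double hL hv hA
    refine sum_cost_le_of_card_le_three he hD hext.level_eqs.2.2.2
      (K := {x + x, u + u, x + u}) Finset.card_le_three fun z hz hzK => ?_
    simp only [Finset.mem_insert, Finset.mem_singleton, not_or] at hzK
    exact hext.cost_lt_of_left_double hv hA hz hzK.1 hzK.2.1 hzK.2.2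
  by_cases huuu : ∃ v ∈ S.star, u + u + u + v ∈ S.apery
  · obtain ⟨v, hv, hA⟩ := huuu
    have hext := h.extendedTriple_right_triple hL hv hA
    refine sum_cost_le_of_card_le_three he hD hext.level_eqs.2.2.2
      (K := {u + u, x + u, u + u + u}) Finset.card_le_three fun z hz hzK => ?_
    simp only [Finset.mem_insert, Finset.mem_singleton, not_or] at hzK
    exact hext.cost_lt_of_right_triple hv hA hz hzK.1 hzK.2.1 hzK.2.2
  · exact h.sum_cost_le_of_notMem he hL (fun v hv hA => hxx ⟨v, hv, hA⟩)
      fun v hv hA => huuu ⟨v, hv, hA⟩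

end ExtendedTriple

theorem sum_cost_le {S : NumericalSemigroup} (he : 3 ≤ S.embeddingDimension)
    (hD : #S.decomposables ≤ 2 * S.embeddingDimension) :
    ∑ z ∈ S.decomposables, S.cost z ≤ S.embeddingDimension * ∑ w ∈ S.apery, S.level w := by
  rcases le_or_gt (2 * S.depth) (∑ w ∈ S.apery, S.level w) with hL | hL
  · calc ∑ z ∈ S.decomposables, S.cost z ≤ #S.decomposables * S.depth :=
          Finset.sum_le_card_nsmul _ _ _ fun z _ => S.cost_le_depth z
      _ ≤ S.embeddingDimension * (2 * S.depth) := by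
          rw [← mul_assoc, mul_comm _ 2]
          exact Nat.mul_le_mul_right _ hD
      _ ≤ _ := Nat.mul_le_mul_left _ hL
  by_cases hS : S.DiagonalTriples
  · exact hS.sum_cost_le he
  · obtain ⟨x, u, h⟩ := exists_mixedTriple hL hS
    exact h.sum_cost_le he hD hL

section SmallEmbeddingDimension

variable {S : NumericalSemigroup} {h w x : ℕ}

theorem satisfiesWilf_of_aperyPrimitives_eq_empty (hP : S.aperyPrimitives = ∅) :
    S.SatisfiesWilf := by
  have hD : S.decomposables = ∅ := Finset.eq_empty_of_forall_notMem fun z hz => by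
    obtain ⟨t, ht, -⟩ := exists_aperyPrimitive_add_apery hz
    exact Finset.notMem_empty t (hP ▸ ht)
  refine satisfiesWilf_of_sum_cost_le ?_
  rw [hD, Finset.sum_empty]
  exact Nat.zero_le _

theorem exists_eq_mul_of_aperyPrimitives_eq_singleton (hP : S.aperyPrimitives = {x})
    (hw : w ∈ insert 0 S.apery) : ∃ k, w = k * x := by
  induction w using Nat.strong_induction_on with
  | _ w ih =>
    rcases Finset.mem_insert.1 hw with rfl | hwA
    · exact ⟨0, (zero_mul x).symm⟩
    obtain ⟨t, ht, r, hr, rfl⟩ := exists_aperyPrimitive_add hwA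
    have ht' := mem_star_of_mem_aperyPrimitives ht
    have hrA : r ∈ insert 0 S.apery := Finset.mem_insert.2 <| or_iff_not_imp_left.2 fun hr0 =>
      mem_apery_of_add_right ht'.1 ⟨hr, hr0⟩ hwA
    obtain ⟨k, rfl⟩ := ih r (by have := pos_of_mem_star ht'; omega) hrA
    obtain rfl := Finset.mem_singleton.1 (hP ▸ ht)
    exact ⟨k + 1, by ring⟩

theorem exists_add_mul_multiplicity_mem_apery (hh : h ∉ S) :
    ∃ j, h + (j + 1) * S.multiplicity ∈ S.apery := by
  obtain ⟨w, hw, hmod⟩ := S.exists_mem_insert_zero_apery_mod_eq (Nat.mod_lt h S.multiplicity_pos)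
  have hwS := mem_of_mem_insert_zero_apery hw
  have hlt : h < w := by
    by_contra! hle
    obtain ⟨j, hj⟩ := (Nat.modEq_iff_dvd' hle).1 hmod
    rw [mul_comm] at hj
    exact hh ((Nat.sub_eq_iff_eq_add' hle).1 hj ▸ add_mem hwS (mul_mem j S.multiplicity_mem))
  obtain ⟨j, hj⟩ := (Nat.modEq_iff_dvd' hlt.le).1 hmod.symm
  obtain ⟨i, rfl⟩ : ∃ i, j = i + 1 := Nat.exists_eq_succ_of_ne_zero fun h0 => by
    rw [h0, mul_zero] at hj
    omega
  rw [mul_comm] at hj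
  refine ⟨i, ?_⟩
  rw [← (Nat.sub_eq_iff_eq_add' hlt.le).1 hj]
  exact Finset.mem_of_mem_insert_of_ne hw (by omega)

theorem natConductor_sub_one_notMem (hc : 0 < S.natConductor) : S.natConductor - 1 ∉ S := by
  intro hmem
  have := frobenius_ne hmem
  have := S.natCast_natConductor
  unfold conductor at this
  omega

theorem exists_mem_add_add_one_eq_natConductor (hP : S.aperyPrimitives = {x}) (hh : h ∉ S) :
    ∃ s ∈ S, s + h + 1 = S.natConductor := by
  have hc : h < S.natConductor := not_le.1 fun hle => hh (mem_of_natConductor_le hle)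
  obtain ⟨j, hj⟩ := exists_add_mul_multiplicity_mem_apery hh
  obtain ⟨l, hl⟩ := exists_add_mul_multiplicity_mem_apery
    (natConductor_sub_one_notMem (Nat.zero_lt_of_lt hc))
  obtain ⟨i, hi⟩ := exists_eq_mul_of_aperyPrimitives_eq_singleton hP (Finset.mem_insert_of_mem hj)
  obtain ⟨k, hk⟩ := exists_eq_mul_of_aperyPrimitives_eq_singleton hP (Finset.mem_insert_of_mem hl)
  have hxS : x ∈ S := (mem_star_of_mem_aperyPrimitives (hP ▸ Finset.mem_singleton_self x)).1
  have hjlt := lt_natConductor_add_multiplicity hj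
  have hllt := lt_natConductor_add_multiplicity hl
  rw [add_one_mul] at hi hk hjlt hllt
  refine ⟨(k - i) * x + j * S.multiplicity,
    add_mem (mul_mem _ hxS) (mul_mem j S.multiplicity_mem), ?_⟩
  rw [Nat.sub_mul]
  omega

theorem natConductor_le_two_mul_ncard_leftPart (hP : S.aperyPrimitives = {x}) :
    S.natConductor ≤ 2 * S.leftPart.ncard := by
  classical
  have hleft : S.leftPart.ncard = #{a ∈ Finset.range S.natConductor | a ∈ S} := by
    rw [← Set.ncard_coe_finset]
    congr 1
    ext a
    rw [mem_leftPart_iff, Finset.mem_coe, Finset.mem_filter, Finset.mem_range, and_comm]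
  have hgaps : #{a ∈ Finset.range S.natConductor | a ∉ S}
      ≤ #{a ∈ Finset.range S.natConductor | a ∈ S} := by
    refine Finset.card_le_card_of_injOn (fun a => S.natConductor - 1 - a) ?_ ?_
    · intro a ha
      obtain ⟨s, hs, e⟩ :=
        exists_mem_add_add_one_eq_natConductor hP (Finset.mem_filter.1 ha).2
      simp only [Finset.coe_filter, Finset.mem_range, Set.mem_ofPred_eq]
      rw [show S.natConductor - 1 - a = s by omega]
      exact ⟨by omega, hs⟩
    · intro a ha b hb e
      simp only [Finset.coe_filter, Finset.mem_range, Set.mem_ofPred_eq] at ha hb e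
      omega
  have hcard := Finset.card_filter_add_card_filter_not (s := Finset.range S.natConductor) (· ∈ S)
  rw [Finset.card_range] at hcard
  omega

end SmallEmbeddingDimension

theorem satisfiesWilf_of_multiplicity_le {S : NumericalSemigroup}
    (h : S.multiplicity ≤ 3 * S.embeddingDimension) : S.SatisfiesWilf := by
  have hP := S.embeddingDimension_eq
  rcases lt_or_ge S.embeddingDimension 3 with he | he
  · rcases Nat.eq_zero_or_pos #S.aperyPrimitives with h0 | hpos
    · exact satisfiesWilf_of_aperyPrimitives_eq_empty (Finset.card_eq_zero.1 h0)
    · obtain ⟨x, hx⟩ := Finset.card_eq_one.1 (by omega : #S.aperyPrimitives = 1)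
      rw [satisfiesWilf_iff, hP, hx, Finset.card_singleton]
      exact natConductor_le_two_mul_ncard_leftPart hx
  · have := S.multiplicity_eq_embeddingDimension_add
    exact satisfiesWilf_of_sum_cost_le (sum_cost_le he (by omega))

section Child

variable {S T : NumericalSemigroup} {a b : ℕ}

theorem mem_iff_of_coe_eq_sdiff_singleton (hT : (T : Set ℕ) = (S : Set ℕ) \ {a}) :
    b ∈ T ↔ b ∈ S ∧ b ≠ a := by
  rw [← SetLike.mem_coe, hT, Set.mem_sdiff_singleton, SetLike.mem_coe]

theorem IsChild.genus_eq (h : T.IsChild S) : T.genus = S.genus + 1 := by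
  obtain ⟨a, ⟨ha, -⟩, hT⟩ := h
  have hcompl : (T : Set ℕ)ᶜ = insert a (S : Set ℕ)ᶜ := by
    ext b
    rw [Set.mem_compl_iff, SetLike.mem_coe, mem_iff_of_coe_eq_sdiff_singleton hT,
      Set.mem_insert_iff, Set.mem_compl_iff, SetLike.mem_coe]
    tauto
  rw [genus, hcompl,
    Set.ncard_insert_of_notMem (Set.notMem_compl_iff.2 ha.1.1) S.finite_compl, genus]

theorem primitives_sdiff_subset (hT : (T : Set ℕ) = (S : Set ℕ) \ {a}) :
    S.primitives \ {a} ⊆ T.primitives := by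
  have hstar : T.star ⊆ S.star := fun b hb =>
    ⟨((mem_iff_of_coe_eq_sdiff_singleton hT).1 hb.1).1, hb.2⟩
  rintro p ⟨⟨⟨hp, hp0⟩, hdec⟩, hpa⟩
  refine ⟨⟨(mem_iff_of_coe_eq_sdiff_singleton hT).2 ⟨hp, hpa⟩, hp0⟩, ?_⟩
  rintro ⟨x, hx, y, hy, e⟩
  exact hdec ⟨x, hstar hx, y, hstar hy, e⟩

theorem embeddingDimension_le_add_one (hT : (T : Set ℕ) = (S : Set ℕ) \ {a})
    (ha : a ∈ S.primitives) : S.embeddingDimension ≤ T.embeddingDimension + 1 := by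
  rw [embeddingDimension, ← Set.ncard_sdiff_singleton_add_one ha S.finite_primitives]
  exact Nat.succ_le_succ (Set.ncard_le_ncard (primitives_sdiff_subset hT) T.finite_primitives)

theorem multiplicity_le_of_ne_multiplicity (hT : (T : Set ℕ) = (S : Set ℕ) \ {a})
    (ha : a ≠ S.multiplicity) : T.multiplicity ≤ S.multiplicity :=
  multiplicity_le ⟨(mem_iff_of_coe_eq_sdiff_singleton hT).2 ⟨S.multiplicity_mem, ha.symm⟩,
    S.isLeast_multiplicity.1.2⟩

section RemoveMultiplicity

variable (hT : (T : Set ℕ) = (S : Set ℕ) \ {S.multiplicity})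
  (hm : S.multiplicity ∈ S.rightPart)
include hT hm

theorem mem_star_iff_of_eq_sdiff_multiplicity : b ∈ T.star ↔ S.multiplicity < b := by
  constructor
  · rintro ⟨hb, hb0⟩
    obtain ⟨hbS, hbm⟩ := (mem_iff_of_coe_eq_sdiff_singleton hT).1 hb
    exact lt_of_le_of_ne (multiplicity_le ⟨hbS, hb0⟩) hbm.symm
  · intro hb
    have hbS : b ∈ S := S.mem_of_frobenius_lt (hm.2.trans (Nat.cast_lt.2 hb))
    exact ⟨(mem_iff_of_coe_eq_sdiff_singleton hT).2 ⟨hbS, hb.ne'⟩, Nat.ne_zero_of_lt hb⟩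

theorem multiplicity_le_of_eq_sdiff_multiplicity : T.multiplicity ≤ S.multiplicity + 1 :=
  multiplicity_le ((mem_star_iff_of_eq_sdiff_multiplicity hT hm).2 (Nat.lt_succ_self _))

/-- The loss of the primitive element `m` is compensated by the gain of `2 m + 1`. -/
theorem embeddingDimension_le_of_eq_sdiff_multiplicity :
    S.embeddingDimension ≤ T.embeddingDimension := by
  have hmP : S.multiplicity ∈ S.primitives := by
    rw [primitives_eq_insert]
    exact Set.mem_insert _ _
  have hstar := fun b => mem_star_iff_of_eq_sdiff_multiplicity hT hm (b := b)
  have hnew : S.multiplicity + (S.multiplicity + 1) ∈ T.primitives := by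
    refine ⟨(hstar _).2 (by omega), ?_⟩
    rintro ⟨x, hx, y, hy, e⟩
    rw [hstar] at hx hy
    omega
  have hsucc : S.multiplicity + 1 ∈ S.star :=
    ⟨S.mem_of_frobenius_lt (hm.2.trans (Nat.cast_lt.2 (Nat.lt_succ_self _))), Nat.succ_ne_zero _⟩
  have hnot : S.multiplicity + (S.multiplicity + 1) ∉ S.primitives \ {S.multiplicity} :=
    fun h => add_notMem_primitives S.isLeast_multiplicity.1 hsucc h.1
  rw [embeddingDimension, ← Set.ncard_sdiff_singleton_add_one hmP S.finite_primitives,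
    ← Set.ncard_insert_of_notMem hnot (S.finite_primitives.subset Set.sdiff_subset)]
  exact Set.ncard_le_ncard (Set.insert_subset hnew (primitives_sdiff_subset hT))
    T.finite_primitives

end RemoveMultiplicity

theorem IsChild.three_mul_embeddingDimension_add_le (h : T.IsChild S) :
    3 * S.embeddingDimension + T.multiplicity
      ≤ 3 * T.embeddingDimension + S.multiplicity + 3 := by
  obtain ⟨a, ⟨haP, haR⟩, hT⟩ := h
  rcases eq_or_ne a S.multiplicity with rfl | ham
  · have := embeddingDimension_le_of_eq_sdiff_multiplicity hT haR
    have := multiplicity_le_of_eq_sdiff_multiplicity hT haR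
    omega
  · have := embeddingDimension_le_add_one hT haP
    have := multiplicity_le_of_ne_multiplicity hT ham
    omega

theorem IsDescendant.three_mul_embeddingDimension_add_le (h : T.IsDescendant S) :
    3 * S.embeddingDimension + 3 * S.genus + T.multiplicity
      ≤ 3 * T.embeddingDimension + 3 * T.genus + S.multiplicity := by
  induction h with
  | refl => omega
  | tail _ hchild ih =>
    have := hchild.three_mul_embeddingDimension_add_le
    have := hchild.genus_eq
    omega

end Child

end NumericalSemigroup

theorem mainTheorem5 (G : ℕ) (hG : 1 ≤ G) (S : NumericalSemigroup) (hg : S.genus ≤ G)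
    (he : (S.embeddingDimension : ℚ) ≥ (S.multiplicity : ℚ) / 3 + ((G : ℚ) - (S.genus : ℚ))) :
    ∀ T : NumericalSemigroup, T.IsDescendant S → T.genus ≤ G → T.SatisfiesWilf := by
  intro T hT hTG
  have hdesc := hT.three_mul_embeddingDimension_add_le
  have hS : S.multiplicity + 3 * G ≤ 3 * S.embeddingDimension + 3 * S.genus := by
    have : (S.multiplicity : ℚ) + 3 * G ≤ 3 * S.embeddingDimension + 3 * S.genus := by linarith
    exact_mod_cast this
  exact NumericalSemigroup.satisfiesWilf_of_multiplicity_le (by omega)
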